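/- Let $p,q\ge 1$ be real numbers and $d$ a positive integer. Let $\|v\|_p=(\sum_i|v_i|^p)^{1/p}$ be the $\ell_p$ norm, and let $\mathcal P_{q,p}(\mathbb R^d)$ be the set of Borel probability measures on $\mathbb R^d$ with finite moment of order $q$ with respect to $\|\cdot\|_p$. For $\alpha,\beta\in\mathcal P_{q,p}(\mathbb R^d)$ let $$W_{q,p}(\alpha,\beta)=\Big(\inf_{\pi\in\Pi(\alpha,\beta)}\int\|u-v\|_p^q\,d\pi(u,v)\Big)^{1/q},$$ where $\Pi(\alpha,\beta)$ is the set of probability measures on $\mathbb R^d\times\mathbb R^d$ with first marginal $\alpha$ and second marginal $\beta$. For a probability measure $\mu$ on $\mathbb R$ with cumulative distribution function $F_\mu$ write $F_\mu^{-1}(t)=\inf\{u\in\mathbb R: F_\mu(u)\ge t\}$, $0<t<1$. Let $x,y\in\mathbb R^d$ and $\mu,\nu\in\mathcal P_{q,p}(\mathbb R)$. Then the product measures $\delta_x\times\mu$ and $\delta_y\times\nu$ belong to $\mathcal P_{q,p}(\mathbb R^{d+1})$, and $$W_{q,p}(\delta_x\times\mu,\delta_y\times\nu)=\Big\{\int_0^1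 c\big(F_\mu^{-1}(t)-F_\nu^{-1}(t)\big)\,dt\Big\}^{1/q},\qquad c(z)=\big(\|x-y\|_p^p+|z|^p\big)^{q/p},$$ where the integral on the right is finite. In particular, for $\mu,\nu\in\mathcal P_{1,1}(\mathbb R)$, $$W_{1,1}(\delta_x\times\mu,\delta_y\times\nu)=\|x-y\|_1+W_{1,1}(\mu,\nu),$$ and for $\mu,\nu\in\mathcal P_{2,2}(\mathbb R)$, $$W_{2,2}(\delta_x\times\mu,\delta_y\times\nu)^2=\|x-y\|_2^2+W_{2,2}(\mu,\nu)^2.$$ -/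

import Mathlib

open MeasureTheory
open scoped ENNReal

noncomputable section

/-- The `ℓ_p` norm `(∑ i, |v i| ^ p) ^ (1 / p)` on `ℝ^d`, for real `p ≥ 1`. -/
def ellNorm {d : ℕ} (p : ℝ) (v : Fin d → ℝ) : ℝ :=
  (∑ i, |v i| ^ p) ^ (1 / p)

/-- `μ ∈ 𝒫_{q,p}(ℝ^d)`: `μ` is a Borel probability measure on `ℝ^d` with finite moment of order
`q` with respect to the `ℓ_p` norm. -/
structure MemP {d : ℕ} (q p : ℝ) (μ : Measure (Fin d → ℝ)) : Prop where
  isProbabilityMeasure : IsProbabilityMeasure μ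
  moment_lt_top : ∫⁻ x, ENNReal.ofReal (ellNorm p x ^ q) ∂μ < ∞

/-- The set `Π(μ, ν)` of couplings of `μ` and `ν`. -/
def couplings {d : ℕ} (μ ν : Measure (Fin d → ℝ)) :
    Set (Measure ((Fin d → ℝ) × (Fin d → ℝ))) :=
  {π | IsProbabilityMeasure π ∧ π.map Prod.fst = μ ∧ π.map Prod.snd = ν}

/-- The transportation cost `𝒯_{q,p}(μ, ν)`: the infimum over all couplings of the integral of
`‖x - y‖_p ^ q`, as an element of `[0, ∞]`. -/
def transportCost {d : ℕ} (q p : ℝ) (μ ν : Measure (Fin d → ℝ)) : ℝ≥0∞ :=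
  ⨅ π ∈ couplings μ ν, ∫⁻ z, ENNReal.ofReal (ellNorm p (z.1 - z.2) ^ q) ∂π

/-- The Wasserstein distance `W_{q,p}(μ, ν) = 𝒯_{q,p}(μ, ν) ^ (1 / q)`. -/
def wassersteinDist {d : ℕ} (q p : ℝ) (μ ν : Measure (Fin d → ℝ)) : ℝ≥0∞ :=
  transportCost q p μ ν ^ (1 / q)

/-- A measure on `ℝ`, regarded as a measure on `ℝ^1`. -/
def onLine (μ : Measure ℝ) : Measure (Fin 1 → ℝ) :=
  μ.map (fun s _ => s)

/-- The product measure `δ_x × μ`, regarded as a measure on `ℝ^(d+1) = ℝ^d × ℝ`. -/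
def diracProd {d : ℕ} (x : Fin d → ℝ) (μ : Measure ℝ) : Measure (Fin (d + 1) → ℝ) :=
  ((Measure.dirac x).prod μ).map (fun z => Fin.snoc (α := fun _ => ℝ) z.1 z.2)

/-- The quantile function `F_μ⁻¹(t) = inf {u : F_μ(u) ≥ t}`, where `F_μ` is the cumulative
distribution function of `μ`. It is only relevant for `0 < t < 1`. -/
def quantileFn (μ : Measure ℝ) (t : ℝ) : ℝ :=
  sInf {u : ℝ | t ≤ ProbabilityTheory.cdf μ u}

end

/-!
Everything reduces to the line. Under a coupling of `δ_x × μ` and `δ_y × ν` the first `d`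
coordinates of the difference are almost surely `x - y`, so its cost is that of a coupling of `μ`
and `ν` for `c (u - v)`, `c z = (‖x - y‖_p ^ p + |z| ^ p) ^ (q / p)`, and every coupling of `μ` and
`ν` arises in this way (`transportCost_diracProd`). The case `d = 0` is the line itself.

On the line, the claim is that the coupling of the two quantile functions is optimal for `c`.
Among all couplings it gives the least mass `(F_ν(s) - F_μ(r))⁺` to each quadrant
`{u > r, v ≤ s}` (`quantileCoupling_quadrant_le`). Integrating over the quadrants with
`r = s + a`, it is optimal for the hinge costs `(u - v - a)⁺` (`quantileCoupling_hinge_le`). Finally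
`c` is even, and on the positive half line it has a nonnegative monotone derivative `g`; writing
`c z - c 0` as the integral of `g` over `(0, z)` and slicing by the superlevel sets of `g`, which are
half lines, exhibits `c` as a constant plus a superposition of hinge costs
(`quantileCoupling_cost_le`). Slicing the first derivative in this way makes no use of a second
derivative, which may be unbounded near `0`.

The optimality holds in `[0, ∞]` for all probability measures; the moment assumptions serve only to
make the integrals finite.
-/

open Set Filter Topology ProbabilityTheory

/-! ### Quantile functions and the quantile coupling -/

/-- The Galois connection between the quantile function and the distribution function. -/
theorem quantileFn_le_iff {μ : Measure ℝ} {t : ℝ} (h0 : 0 < t) (h1 : t < 1) (s : ℝ) :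
    quantileFn μ t ≤ s ↔ t ≤ cdf μ s := by
  have hbdd : BddBelow {u : ℝ | t ≤ cdf μ u} := by
    obtain ⟨u, hu⟩ := ((tendsto_cdf_atBot μ).eventually_lt_const h0).exists
    refine ⟨u, fun w hw => ?_⟩
    by_contra! hlt
    exact absurd ((hw : t ≤ cdf μ w).trans (monotone_cdf μ hlt.le)) hu.not_ge
  have hne : {u : ℝ | t ≤ cdf μ u}.Nonempty := by
    obtain ⟨u, hu⟩ := ((tendsto_cdf_atTop μ).eventually_const_lt h1).exists
    exact ⟨u, hu.le⟩
  refine ⟨fun h => ?_, fun h => csInf_le hbdd h⟩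
  -- By right continuity the infimum defining the quantile is attained.
  have hlim : Tendsto (cdf μ) (𝓝[>] s) (𝓝 (cdf μ s)) :=
    ((cdf μ).right_continuous s).mono_left (nhdsWithin_mono _ Ioi_subset_Ici_self)
  refine ge_of_tendsto hlim ?_
  filter_upwards [self_mem_nhdsWithin] with r hr
  obtain ⟨u, hu, hur⟩ := exists_lt_of_csInf_lt hne (h.trans_lt hr)
  exact (hu : t ≤ cdf μ u).trans (monotone_cdf μ hur.le)

theorem monotoneOn_quantileFn (μ : Measure ℝ) : MonotoneOn (quantileFn μ) (Ioo 0 1) :=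
  fun _ hs _ ht hst => (quantileFn_le_iff hs.1 hs.2 _).2
    (hst.trans ((quantileFn_le_iff ht.1 ht.2 _).1 le_rfl))

theorem aemeasurable_quantileFn (μ : Measure ℝ) :
    AEMeasurable (quantileFn μ) (volume.restrict (Ioo 0 1)) :=
  aemeasurable_restrict_of_monotoneOn measurableSet_Ioo (monotoneOn_quantileFn μ)

instance isProbabilityMeasure_restrict_Ioo_zero_one :
    IsProbabilityMeasure (volume.restrict (Ioo (0 : ℝ) 1)) :=
  ⟨by simp⟩

/-- The quantile function transports the uniform distribution on `(0, 1)` to `μ`. -/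
theorem map_quantileFn (μ : Measure ℝ) [IsProbabilityMeasure μ] :
    (volume.restrict (Ioo 0 1)).map (quantileFn μ) = μ := by
  have := Measure.isProbabilityMeasure_map (aemeasurable_quantileFn μ)
  refine Measure.ext_of_Iic _ _ fun s => ?_
  rw [Measure.map_apply_of_aemeasurable (aemeasurable_quantileFn μ) measurableSet_Iic,
    ← ofReal_cdf, restrict_Ioo_eq_restrict_Ioc, Measure.restrict_apply₀']
  · have hset : (quantileFn μ ⁻¹' Iic s ∩ Ioc 0 1 : Set ℝ) =ᵐ[volume] Ioc 0 (cdf μ s) := by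
      have h1 : ∀ᵐ t : ℝ, t ≠ 1 := by simp [ae_iff]
      filter_upwards [h1] with t ht1
      refine propext ⟨fun h => ?_, fun h => ?_⟩
      · exact ⟨h.2.1, (quantileFn_le_iff h.2.1 (h.2.2.lt_of_ne ht1) s).1 h.1⟩
      · have hle := h.2.trans (cdf_le_one μ s)
        exact ⟨(quantileFn_le_iff h.1 (hle.lt_of_ne ht1) s).2 h.2, h.1, hle⟩
    rw [measure_congr hset]
    simp
  · exact measurableSet_Ioc.nullMeasurableSet

/-- The monotone coupling of `μ` and `ν`: the joint law of the two quantile functions under the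
uniform distribution on `(0, 1)`. -/
noncomputable def quantileCoupling (μ ν : Measure ℝ) : Measure (ℝ × ℝ) :=
  (volume.restrict (Ioo 0 1)).map fun t => (quantileFn μ t, quantileFn ν t)

theorem aemeasurable_quantileFn_prodMk (μ ν : Measure ℝ) :
    AEMeasurable (fun t => (quantileFn μ t, quantileFn ν t)) (volume.restrict (Ioo 0 1)) :=
  (aemeasurable_quantileFn μ).prodMk (aemeasurable_quantileFn ν)

instance isProbabilityMeasure_quantileCoupling (μ ν : Measure ℝ) :
    IsProbabilityMeasure (quantileCoupling μ ν) :=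
  Measure.isProbabilityMeasure_map (aemeasurable_quantileFn_prodMk μ ν)

theorem map_fst_quantileCoupling (μ ν : Measure ℝ) [IsProbabilityMeasure μ] :
    (quantileCoupling μ ν).map Prod.fst = μ := by
  rw [quantileCoupling, AEMeasurable.map_map_of_aemeasurable measurable_fst.aemeasurable
    (aemeasurable_quantileFn_prodMk μ ν)]
  exact map_quantileFn μ

theorem map_snd_quantileCoupling (μ ν : Measure ℝ) [IsProbabilityMeasure ν] :
    (quantileCoupling μ ν).map Prod.snd = ν := by
  rw [quantileCoupling, AEMeasurable.map_map_of_aemeasurable measurable_snd.aemeasurable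
    (aemeasurable_quantileFn_prodMk μ ν)]
  exact map_quantileFn ν

theorem lintegral_quantileCoupling (μ ν : Measure ℝ) {f : ℝ × ℝ → ℝ≥0∞} (hf : Measurable f) :
    ∫⁻ z, f z ∂quantileCoupling μ ν
      = ∫⁻ t in Ioo 0 1, f (quantileFn μ t, quantileFn ν t) :=
  lintegral_map' hf.aemeasurable (aemeasurable_quantileFn_prodMk μ ν)

/-! ### Optimality of the quantile coupling for convex costs -/

theorem measurableSet_Ioi_prod_Iic (r s : ℝ) :
    MeasurableSet {z : ℝ × ℝ | r < z.1 ∧ z.2 ≤ s} :=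
  (measurableSet_lt measurable_const measurable_fst).inter
    (measurableSet_le measurable_snd measurable_const)

/-- Among all couplings, the quantile coupling gives the least mass to every quadrant
`{u > r, v ≤ s}`. -/
theorem quantileCoupling_quadrant_le {μ ν : Measure ℝ} [IsProbabilityMeasure μ]
    [IsProbabilityMeasure ν] {π : Measure (ℝ × ℝ)} (hfst : π.map Prod.fst = μ)
    (hsnd : π.map Prod.snd = ν) (r s : ℝ) :
    quantileCoupling μ ν {z | r < z.1 ∧ z.2 ≤ s} ≤ π {z | r < z.1 ∧ z.2 ≤ s} := by
  trans ENNReal.ofReal (cdf ν s - cdf μ r)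
  · rw [quantileCoupling, Measure.map_apply_of_aemeasurable (aemeasurable_quantileFn_prodMk μ ν)
      (measurableSet_Ioi_prod_Iic r s), Measure.restrict_apply₀' measurableSet_Ioo.nullMeasurableSet,
      ← Real.volume_Ioc]
    refine measure_mono fun t ⟨⟨hr, hs⟩, h0, h1⟩ => ⟨?_, (quantileFn_le_iff h0 h1 s).1 hs⟩
    by_contra! hle
    exact absurd ((quantileFn_le_iff h0 h1 r).2 hle) (not_le.2 hr)
  · rw [ENNReal.ofReal_sub _ (cdf_nonneg μ r), tsub_le_iff_right, ofReal_cdf, ofReal_cdf]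
    conv_lhs => rw [← hsnd]
    conv_rhs => rw [← hfst]
    rw [Measure.map_apply measurable_snd measurableSet_Iic,
      Measure.map_apply measurable_fst measurableSet_Iic]
    refine (measure_mono fun z hz => ?_).trans (measure_union_le _ _)
    by_cases h : z.1 ≤ r
    · exact Or.inr h
    · exact Or.inl ⟨not_le.1 h, hz⟩

/-- The hinge cost `(u - v - a)⁺` is a superposition of indicators of quadrants. -/
theorem lintegral_hinge (π : Measure (ℝ × ℝ)) [IsFiniteMeasure π] (a : ℝ) :
    ∫⁻ z, ENNReal.ofReal (z.1 - z.2 - a) ∂π = ∫⁻ s, π {z | s + a < z.1 ∧ z.2 ≤ s} := by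
  have hS : MeasurableSet {w : (ℝ × ℝ) × ℝ | w.2 + a < w.1.1 ∧ w.1.2 ≤ w.2} :=
    (measurableSet_lt (f := fun w : (ℝ × ℝ) × ℝ => w.2 + a) (g := fun w => w.1.1)
      (by fun_prop) (by fun_prop)).inter
      (measurableSet_le (f := fun w : (ℝ × ℝ) × ℝ => w.1.2) (g := fun w => w.2)
        (by fun_prop) (by fun_prop))
  have h := (Measure.prod_apply (μ := π) (ν := volume) hS).symm.trans
    (Measure.prod_apply_symm (μ := π) (ν := volume) hS)
  refine Eq.trans (lintegral_congr fun z => ?_) h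
  have hz : Prod.mk z ⁻¹' {w : (ℝ × ℝ) × ℝ | w.2 + a < w.1.1 ∧ w.1.2 ≤ w.2}
      = Ico z.2 (z.1 - a) := by
    ext s
    simp only [mem_preimage, mem_ofPred_eq, mem_Ico, lt_sub_iff_add_lt]
    exact and_comm
  rw [hz, Real.volume_Ico]
  ring_nf

theorem quantileCoupling_hinge_le {μ ν : Measure ℝ} [IsProbabilityMeasure μ]
    [IsProbabilityMeasure ν] {π : Measure (ℝ × ℝ)} [IsProbabilityMeasure π]
    (hfst : π.map Prod.fst = μ) (hsnd : π.map Prod.snd = ν) (a : ℝ) :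
    ∫⁻ z, ENNReal.ofReal (z.1 - z.2 - a) ∂quantileCoupling μ ν
      ≤ ∫⁻ z, ENNReal.ofReal (z.1 - z.2 - a) ∂π := by
  rw [lintegral_hinge, lintegral_hinge]
  exact lintegral_mono fun s => quantileCoupling_quadrant_le hfst hsnd _ _

/-- A superlevel set of a monotone function cuts `(0, z)` in an interval, whose length is a hinge
function of `z` (or zero for all `z`). -/
theorem volume_superlevel_eq_hinge {g : ℝ → ℝ} (hg : MonotoneOn g (Ioi 0)) (r : ℝ) :
    (∃ a : ℝ, ∀ z : ℝ, volume {s | (0 < s ∧ s < z) ∧ r < g s} = ENNReal.ofReal (z - a)) ∨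
      ∀ z : ℝ, volume {s | (0 < s ∧ s < z) ∧ r < g s} = 0 := by
  set S : Set ℝ := {s | 0 < s ∧ r < g s} with hS
  rcases S.eq_empty_or_nonempty with hempty | hne
  · refine Or.inr fun z => ?_
    have : {s | (0 < s ∧ s < z) ∧ r < g s} = ∅ :=
      eq_empty_of_subset_empty fun s hs => hempty ▸ (⟨hs.1.1, hs.2⟩ : s ∈ S)
    rw [this, measure_empty]
  · have hbdd : BddBelow S := ⟨0, fun s hs => hs.1.le⟩
    have ha0 : 0 ≤ sInf S := le_csInf hne fun s hs => hs.1.le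
    refine Or.inl ⟨sInf S, fun z => le_antisymm ?_ ?_⟩
    · rw [← Real.volume_Ico]
      exact measure_mono fun s hs => ⟨csInf_le hbdd ⟨hs.1.1, hs.2⟩, hs.1.2⟩
    · rw [← Real.volume_Ioo]
      refine measure_mono fun s hs => ?_
      obtain ⟨u, hu, hus⟩ := exists_lt_of_csInf_lt hne hs.1
      have hs0 : 0 < s := ha0.trans_lt hs.1
      exact ⟨⟨hs0, hs.2⟩, hu.2.trans_le (hg hu.1 hs0 hus.le)⟩

/-- The layer cake formula for a cost with derivative `g`: it is a superposition of the costs in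
`volume_superlevel_eq_hinge`. -/
theorem lintegral_layer (π : Measure (ℝ × ℝ)) [IsFiniteMeasure π] {g : ℝ → ℝ}
    (hmeas : Measurable g) (hnn : ∀ s, 0 < s → 0 ≤ g s) :
    ∫⁻ w, (∫⁻ s in Ioo 0 (w.1 - w.2), ENNReal.ofReal (g s)) ∂π
      = ∫⁻ r in Ioi 0, ∫⁻ w, volume {s | (0 < s ∧ s < w.1 - w.2) ∧ r < g s} ∂π := by
  have hS : MeasurableSet
      {x : ((ℝ × ℝ) × ℝ) × ℝ | (0 < x.2 ∧ x.2 < x.1.1.1 - x.1.1.2) ∧ x.1.2 < g x.2} :=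
    ((measurableSet_lt (f := fun _ : ((ℝ × ℝ) × ℝ) × ℝ => (0 : ℝ)) (g := fun x => x.2)
      (by fun_prop) (by fun_prop)).inter
      (measurableSet_lt (f := fun x : ((ℝ × ℝ) × ℝ) × ℝ => x.2)
        (g := fun x => x.1.1.1 - x.1.1.2) (by fun_prop) (by fun_prop))).inter
      (measurableSet_lt (f := fun x : ((ℝ × ℝ) × ℝ) × ℝ => x.1.2) (g := fun x => g x.2)
        (by fun_prop) (by fun_prop))
  rw [← lintegral_lintegral_swap]
  · refine lintegral_congr fun w => ?_
    rw [lintegral_eq_lintegral_meas_lt _ _ hmeas.aemeasurable]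
    · refine lintegral_congr fun r => ?_
      rw [Measure.restrict_apply₀' measurableSet_Ioo.nullMeasurableSet, inter_comm]
      rfl
    · filter_upwards [ae_restrict_mem measurableSet_Ioo] with s hs using hnn s hs.1
  · exact (measurable_measure_prodMk_left (ν := volume) hS).aemeasurable

/-- The quantile coupling is optimal for the one-sided convex cost whose derivative is `g`. -/
theorem quantileCoupling_primitive_le {μ ν : Measure ℝ} [IsProbabilityMeasure μ]
    [IsProbabilityMeasure ν] {π : Measure (ℝ × ℝ)} [IsProbabilityMeasure π]
    (hfst : π.map Prod.fst = μ) (hsnd : π.map Prod.snd = ν) {g : ℝ → ℝ} (hmeas : Measurable g)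
    (hnn : ∀ s, 0 < s → 0 ≤ g s) (hmono : MonotoneOn g (Ioi 0)) :
    ∫⁻ w, (∫⁻ s in Ioo 0 (w.1 - w.2), ENNReal.ofReal (g s)) ∂quantileCoupling μ ν
      ≤ ∫⁻ w, (∫⁻ s in Ioo 0 (w.1 - w.2), ENNReal.ofReal (g s)) ∂π := by
  rw [lintegral_layer _ hmeas hnn, lintegral_layer _ hmeas hnn]
  refine lintegral_mono fun r => ?_
  rcases volume_superlevel_eq_hinge hmono r with ⟨a, ha⟩ | h
  · simp only [ha]
    exact quantileCoupling_hinge_le hfst hsnd a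
  · simp [h]

theorem map_swap_quantileCoupling (μ ν : Measure ℝ) :
    (quantileCoupling μ ν).map Prod.swap = quantileCoupling ν μ := by
  rw [quantileCoupling, AEMeasurable.map_map_of_aemeasurable measurable_swap.aemeasurable
    (aemeasurable_quantileFn_prodMk μ ν)]
  rfl

theorem measurable_lintegral_Ioo_zero {g : ℝ → ℝ} :
    Measurable fun z : ℝ => ∫⁻ s in Ioo 0 z, ENNReal.ofReal (g s) :=
  Monotone.measurable fun _ _ h => lintegral_mono_set (Ioo_subset_Ioo_right h)

/-- The quantile coupling is optimal for a cost `c (u - v)` that is, up to an additive constant,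
the even function with derivative `g` on the positive half line, `g` being nonnegative and
monotone. -/
theorem quantileCoupling_cost_le {μ ν : Measure ℝ} [IsProbabilityMeasure μ]
    [IsProbabilityMeasure ν] {π : Measure (ℝ × ℝ)} [IsProbabilityMeasure π]
    (hfst : π.map Prod.fst = μ) (hsnd : π.map Prod.snd = ν) {g : ℝ → ℝ} (hmeas : Measurable g)
    (hnn : ∀ s, 0 < s → 0 ≤ g s) (hmono : MonotoneOn g (Ioi 0)) {c : ℝ → ℝ≥0∞}
    (hc : ∀ z, 0 ≤ z → c z = c 0 + ∫⁻ s in Ioo 0 z, ENNReal.ofReal (g s))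
    (heven : ∀ z, c (-z) = c z) :
    ∫⁻ w, c (w.1 - w.2) ∂quantileCoupling μ ν ≤ ∫⁻ w, c (w.1 - w.2) ∂π := by
  set C : ℝ → ℝ≥0∞ := fun z => ∫⁻ s in Ioo 0 z, ENNReal.ofReal (g s) with hCdef
  have hC : Measurable C := measurable_lintegral_Ioo_zero
  have hC0 : ∀ z ≤ 0, C z = 0 := fun z hz => by simp [hCdef, Ioo_eq_empty hz.not_gt]
  have hsplit : ∀ w : ℝ × ℝ, c (w.1 - w.2) = c 0 + (C (w.1 - w.2) + C (w.2 - w.1)) := by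
    intro w
    rcases le_total 0 (w.1 - w.2) with h | h
    · rw [hC0 (w.2 - w.1) (by linarith), add_zero, hc _ h]
    · rw [hC0 _ h, zero_add, ← heven, neg_sub, hc _ (by linarith)]
  have hint : ∀ ρ : Measure (ℝ × ℝ), IsProbabilityMeasure ρ → ∫⁻ w, c (w.1 - w.2) ∂ρ
      = c 0 + (∫⁻ w, C (w.1 - w.2) ∂ρ + ∫⁻ w, C (w.1 - w.2) ∂ρ.map Prod.swap) := by
    intro ρ _
    rw [lintegral_map (by fun_prop) measurable_swap]
    simp only [hsplit, Prod.fst_swap, Prod.snd_swap]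
    rw [lintegral_add_left measurable_const, lintegral_add_left (by fun_prop)]
    simp
  have := Measure.isProbabilityMeasure_map (μ := π) measurable_swap.aemeasurable
  rw [hint _ inferInstance, hint _ inferInstance, map_swap_quantileCoupling]
  gcongr c 0 + (?_ + ?_)
  · exact quantileCoupling_primitive_le hfst hsnd hmeas hnn hmono
  · refine quantileCoupling_primitive_le ?_ ?_ hmeas hnn hmono
    · rw [Measure.map_map measurable_fst measurable_swap]; exact hsnd
    · rw [Measure.map_map measurable_snd measurable_swap]; exact hfst

/-! ### The cost `(A + |z| ^ p) ^ (q / p)` -/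

theorem monotoneOn_cost_deriv {p q A : ℝ} (hp : 1 ≤ p) (hq : 1 ≤ q) (hA : 0 ≤ A) :
    MonotoneOn (fun s : ℝ => q * s ^ (p - 1) * (A + s ^ p) ^ (q / p - 1)) (Ioi 0) := by
  have hp0 : 0 < p := by linarith
  intro s (hs : 0 < s) t (ht : 0 < t) hst
  have hsp : s ^ p ≤ t ^ p := Real.rpow_le_rpow hs.le hst hp0.le
  have hs' := Real.rpow_pos_of_pos hs p
  have ht' := Real.rpow_pos_of_pos ht p
  rcases le_total p q with h | h
  · have h1 : 0 ≤ q / p - 1 := by rw [sub_nonneg, one_le_div hp0]; exact h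
    dsimp only
    gcongr
  · -- For `q < p` the derivative is `q * s ^ (q - 1) * (s ^ p / (A + s ^ p)) ^ (1 - q / p)`.
    have key : ∀ u : ℝ, 0 < u → q * u ^ (p - 1) * (A + u ^ p) ^ (q / p - 1)
        = q * u ^ (q - 1) * (u ^ p / (A + u ^ p)) ^ (1 - q / p) := by
      intro u hu
      have hu' := Real.rpow_pos_of_pos hu p
      rw [Real.div_rpow hu'.le (by linarith), ← Real.rpow_mul hu.le,
        show q / p - 1 = -(1 - q / p) by ring, Real.rpow_neg (by linarith),
        show p * (1 - q / p) = p - q by field_simp, show p - 1 = (q - 1) + (p - q) by ring,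
        Real.rpow_add hu]
      ring
    have h1 : 0 ≤ 1 - q / p := by rw [sub_nonneg, div_le_one hp0]; exact h
    simp only
    rw [key s hs, key t ht]
    have h2 : s ^ p / (A + s ^ p) ≤ t ^ p / (A + t ^ p) := by
      rw [div_le_div_iff₀ (by linarith) (by linarith)]
      nlinarith
    gcongr

theorem cost_eq_primitive {p q A : ℝ} (hp : 1 ≤ p) (hq : 1 ≤ q) (hA : 0 ≤ A) {z : ℝ}
    (hz : 0 ≤ z) :
    ENNReal.ofReal ((A + |z| ^ p) ^ (q / p)) = ENNReal.ofReal ((A + |0| ^ p) ^ (q / p))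
      + ∫⁻ s in Ioo 0 z, ENNReal.ofReal (q * s ^ (p - 1) * (A + s ^ p) ^ (q / p - 1)) := by
  have hp0 : 0 < p := by linarith
  have hq0 : 0 < q := by linarith
  have hcont : ContinuousOn (fun s : ℝ => (A + s ^ p) ^ (q / p)) (Icc 0 z) :=
    ((continuous_const.add (Real.continuous_rpow_const hp0.le)).rpow_const
      fun _ => Or.inr (by positivity)).continuousOn
  have hderiv : ∀ s ∈ Ioo 0 z, HasDerivAt (fun s : ℝ => (A + s ^ p) ^ (q / p))
      (q * s ^ (p - 1) * (A + s ^ p) ^ (q / p - 1)) s := by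
    intro s hs
    have hs' := Real.rpow_pos_of_pos hs.1 p
    have h := ((Real.hasDerivAt_rpow_const (p := p) (Or.inl hs.1.ne')).const_add A).rpow_const
      (p := q / p) (Or.inl (by linarith))
    convert h using 1
    field_simp
  have hnn : ∀ s ∈ Ioo 0 z, 0 ≤ q * s ^ (p - 1) * (A + s ^ p) ^ (q / p - 1) := by
    intro s hs
    have := hs.1
    positivity
  have hint := intervalIntegral.integrableOn_deriv_of_nonneg hcont hderiv hnn
  have hftc := intervalIntegral.integral_eq_sub_of_hasDerivAt_of_le hz hcont hderiv
    ((intervalIntegrable_iff_integrableOn_Ioc_of_le hz).2 hint)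
  rw [intervalIntegral.integral_of_le hz, integral_Ioc_eq_integral_Ioo] at hftc
  rw [← ofReal_integral_eq_lintegral_ofReal (hint.mono_set Ioo_subset_Ioc_self)
    ((ae_restrict_mem measurableSet_Ioo).mono hnn), hftc, abs_of_nonneg hz, abs_zero,
    ← ENNReal.ofReal_add (by positivity)]
  · ring_nf
  · rw [sub_nonneg]
    gcongr

/-- The quantile coupling minimises the transport cost `(A + |u - v| ^ p) ^ (q / p)`. -/
theorem lintegral_quantile_cost_le {p q A : ℝ} (hp : 1 ≤ p) (hq : 1 ≤ q) (hA : 0 ≤ A)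
    {μ ν : Measure ℝ} [IsProbabilityMeasure μ] [IsProbabilityMeasure ν] {π : Measure (ℝ × ℝ)}
    [IsProbabilityMeasure π] (hfst : π.map Prod.fst = μ) (hsnd : π.map Prod.snd = ν) :
    ∫⁻ t in Ioo 0 1, ENNReal.ofReal ((A + |quantileFn μ t - quantileFn ν t| ^ p) ^ (q / p))
      ≤ ∫⁻ w, ENNReal.ofReal ((A + |w.1 - w.2| ^ p) ^ (q / p)) ∂π := by
  rw [← lintegral_quantileCoupling μ ν
    (f := fun w => ENNReal.ofReal ((A + |w.1 - w.2| ^ p) ^ (q / p))) (by fun_prop)]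
  refine quantileCoupling_cost_le hfst hsnd (by fun_prop) (fun s hs => ?_)
    (monotoneOn_cost_deriv hp hq hA)
    (c := fun z => ENNReal.ofReal ((A + |z| ^ p) ^ (q / p)))
    (fun z hz => cost_eq_primitive hp hq hA hz) (fun z => by simp only [abs_neg])
  positivity

/-! ### Reduction of `δ_x × μ` to the line -/

theorem ellNorm_nonneg {d : ℕ} (p : ℝ) (v : Fin d → ℝ) : 0 ≤ ellNorm p v :=
  Real.rpow_nonneg (Finset.sum_nonneg fun _ _ => Real.rpow_nonneg (abs_nonneg _) _) _

theorem ellNorm_rpow {d : ℕ} {p : ℝ} (hp : 1 ≤ p) (q : ℝ) (v : Fin (d + 1) → ℝ) :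
    ellNorm p v ^ q = (ellNorm p (Fin.init v) ^ p + |v (Fin.last d)| ^ p) ^ (q / p) := by
  have hp0 : p ≠ 0 := by linarith
  have hsum : ∀ {n : ℕ} (w : Fin n → ℝ), 0 ≤ ∑ i, |w i| ^ p := fun w =>
    Finset.sum_nonneg fun _ _ => Real.rpow_nonneg (abs_nonneg _) _
  rw [ellNorm, ← Real.rpow_mul (hsum v), ellNorm, ← Real.rpow_mul (hsum _),
    one_div_mul_cancel hp0, Real.rpow_one, Fin.sum_univ_castSucc, one_div_mul_eq_div]
  rfl

theorem ellNorm_zero_dim {p : ℝ} (hp : 1 ≤ p) (v : Fin 0 → ℝ) : ellNorm p v = 0 := by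
  have : 1 / p ≠ 0 := by positivity
  rw [ellNorm, Finset.univ_eq_empty, Finset.sum_empty, Real.zero_rpow this]

theorem measurable_snoc_const {d : ℕ} (x : Fin d → ℝ) :
    Measurable fun u : ℝ => (Fin.snoc x u : Fin (d + 1) → ℝ) := by
  refine measurable_pi_iff.2 fun i => ?_
  induction i using Fin.lastCases with
  | last => simpa using measurable_id'
  | cast j => simp

theorem measurable_snoc_prod (d : ℕ) :
    Measurable fun z : (Fin d → ℝ) × ℝ => (Fin.snoc z.1 z.2 : Fin (d + 1) → ℝ) := by
  refine measurable_pi_iff.2 fun i => ?_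
  induction i using Fin.lastCases with
  | last => simpa using measurable_snd
  | cast j => simp only [Fin.snoc_castSucc]; fun_prop

theorem measurable_init (d : ℕ) :
    Measurable fun v : Fin (d + 1) → ℝ => (Fin.init v : Fin d → ℝ) :=
  measurable_pi_iff.2 fun i => measurable_pi_apply i.castSucc

theorem diracProd_eq_map {d : ℕ} (x : Fin d → ℝ) (μ : Measure ℝ) [SFinite μ] :
    diracProd x μ = μ.map fun u => (Fin.snoc x u : Fin (d + 1) → ℝ) := by
  rw [diracProd, Measure.dirac_prod, Measure.map_map (measurable_snoc_prod d) (by fun_prop)]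
  rfl

theorem isProbabilityMeasure_diracProd {d : ℕ} (x : Fin d → ℝ) (μ : Measure ℝ)
    [IsProbabilityMeasure μ] : IsProbabilityMeasure (diracProd x μ) := by
  rw [diracProd_eq_map]
  exact Measure.isProbabilityMeasure_map (measurable_snoc_const x).aemeasurable

theorem map_last_diracProd {d : ℕ} (x : Fin d → ℝ) (μ : Measure ℝ) [SFinite μ] :
    (diracProd x μ).map (fun v => v (Fin.last d)) = μ := by
  rw [diracProd_eq_map, Measure.map_map (by fun_prop) (measurable_snoc_const x)]
  simp [Function.comp_def]

theorem ae_init_diracProd {d : ℕ} (x : Fin d → ℝ) (μ : Measure ℝ) [SFinite μ] :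
    ∀ᵐ v ∂diracProd x μ, Fin.init v = x := by
  rw [diracProd_eq_map, ae_map_iff (measurable_snoc_const x).aemeasurable
    (measurableSet_eq_fun (measurable_init d) measurable_const)]
  simp

/-- The line `ℝ^1` is the case `d = 0` of `ℝ^d × ℝ`. -/
theorem onLine_eq_diracProd (x : Fin 0 → ℝ) (μ : Measure ℝ) [SFinite μ] :
    onLine μ = diracProd x μ := by
  rw [onLine, diracProd_eq_map]
  congr 1

/-- Under a coupling of `δ_x × μ` and `δ_y × ν` only the last coordinates are random. -/
theorem lintegral_cost_of_mem_couplings {d : ℕ} {x y : Fin d → ℝ} {μ ν : Measure ℝ} [SFinite μ]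
    [SFinite ν] {π : Measure ((Fin (d + 1) → ℝ) × (Fin (d + 1) → ℝ))}
    (hπ : π ∈ couplings (diracProd x μ) (diracProd y ν)) {p : ℝ} (hp : 1 ≤ p) (q : ℝ) :
    ∫⁻ z, ENNReal.ofReal (ellNorm p (z.1 - z.2) ^ q) ∂π
      = ∫⁻ w, ENNReal.ofReal ((ellNorm p (x - y) ^ p + |w.1 - w.2| ^ p) ^ (q / p))
          ∂π.map fun z => (z.1 (Fin.last d), z.2 (Fin.last d)) := by
  obtain ⟨-, hfst, hsnd⟩ := hπ
  rw [lintegral_map (by fun_prop) (by fun_prop)]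
  refine lintegral_congr_ae ?_
  have h1 : ∀ᵐ z ∂π, Fin.init z.1 = x :=
    ae_of_ae_map measurable_fst.aemeasurable (hfst ▸ ae_init_diracProd x μ)
  have h2 : ∀ᵐ z ∂π, Fin.init z.2 = y :=
    ae_of_ae_map measurable_snd.aemeasurable (hsnd ▸ ae_init_diracProd y ν)
  filter_upwards [h1, h2] with z hz1 hz2
  rw [ellNorm_rpow hp, show Fin.init (z.1 - z.2) = x - y by rw [← hz1, ← hz2]; rfl]
  rfl

/-- The transportation cost between `δ_x × μ` and `δ_y × ν`, for arbitrary probability measures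
`μ` and `ν`. -/
theorem transportCost_diracProd {d : ℕ} (x y : Fin d → ℝ) {p q : ℝ} (hp : 1 ≤ p) (hq : 1 ≤ q)
    (μ ν : Measure ℝ) [IsProbabilityMeasure μ] [IsProbabilityMeasure ν] :
    transportCost q p (diracProd x μ) (diracProd y ν)
      = ∫⁻ t in Ioo 0 1, ENNReal.ofReal
          ((ellNorm p (x - y) ^ p + |quantileFn μ t - quantileFn ν t| ^ p) ^ (q / p)) := by
  have hA : 0 ≤ ellNorm p (x - y) ^ p := Real.rpow_nonneg (ellNorm_nonneg p _) _
  refine le_antisymm ?_ ?_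
  · have hx := measurable_snoc_const x
    have hy := measurable_snoc_const y
    let e : ℝ × ℝ → (Fin (d + 1) → ℝ) × (Fin (d + 1) → ℝ) :=
      fun w => (Fin.snoc x w.1, Fin.snoc y w.2)
    have he : Measurable e := (hx.comp measurable_fst).prodMk (hy.comp measurable_snd)
    have hmem : (quantileCoupling μ ν).map e ∈ couplings (diracProd x μ) (diracProd y ν) := by
      refine ⟨Measure.isProbabilityMeasure_map he.aemeasurable, ?_, ?_⟩
      · rw [Measure.map_map measurable_fst he, diracProd_eq_map]
        conv_rhs => rw [← map_fst_quantileCoupling μ ν, Measure.map_map hx measurable_fst]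
        rfl
      · rw [Measure.map_map measurable_snd he, diracProd_eq_map]
        conv_rhs => rw [← map_snd_quantileCoupling μ ν, Measure.map_map hy measurable_snd]
        rfl
    refine (iInf₂_le _ hmem).trans_eq ?_
    rw [lintegral_cost_of_mem_couplings hmem hp, Measure.map_map (by fun_prop) he,
      ← lintegral_quantileCoupling μ ν (f := fun w => ENNReal.ofReal
        ((ellNorm p (x - y) ^ p + |w.1 - w.2| ^ p) ^ (q / p))) (by fun_prop)]
    simp [e, Function.comp_def]
  · refine le_iInf₂ fun π hπ => ?_
    rw [lintegral_cost_of_mem_couplings hπ hp]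
    obtain ⟨_, hfst, hsnd⟩ := hπ
    have hlast : Measurable fun z : (Fin (d + 1) → ℝ) × (Fin (d + 1) → ℝ) =>
      (z.1 (Fin.last d), z.2 (Fin.last d)) := by fun_prop
    have := Measure.isProbabilityMeasure_map (μ := π) hlast.aemeasurable
    refine lintegral_quantile_cost_le hp hq hA ?_ ?_
    · rw [Measure.map_map measurable_fst hlast, ← map_last_diracProd x μ, ← hfst,
        Measure.map_map (by fun_prop) measurable_fst]
      rfl
    · rw [Measure.map_map measurable_snd hlast, ← map_last_diracProd y ν, ← hsnd,
        Measure.map_map (by fun_prop) measurable_snd]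
      rfl

theorem transportCost_onLine {p q : ℝ} (hp : 1 ≤ p) (hq : 1 ≤ q)
    (μ ν : Measure ℝ) [IsProbabilityMeasure μ] [IsProbabilityMeasure ν] :
    transportCost q p (onLine μ) (onLine ν)
      = ∫⁻ t in Ioo 0 1, ENNReal.ofReal (|quantileFn μ t - quantileFn ν t| ^ q) := by
  have hp0 : p ≠ 0 := by linarith
  rw [onLine_eq_diracProd 0, onLine_eq_diracProd 0, transportCost_diracProd _ _ hp hq]
  simp only [ellNorm_zero_dim hp, Real.zero_rpow hp0, zero_add, ← Real.rpow_mul (abs_nonneg _),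
    mul_div_cancel₀ q hp0]

/-! ### Moments -/

theorem isProbabilityMeasure_of_memP_onLine {p q : ℝ} {μ : Measure ℝ}
    (h : MemP q p (onLine μ)) : IsProbabilityMeasure μ := by
  have : IsProbabilityMeasure (μ.map fun s => (fun _ => s : Fin 1 → ℝ)) := h.1
  exact Measure.isProbabilityMeasure_of_map fun s => (fun _ => s : Fin 1 → ℝ)

theorem lintegral_ellNorm_diracProd {d : ℕ} (x : Fin d → ℝ) (μ : Measure ℝ) [SFinite μ] {p : ℝ}
    (hp : 1 ≤ p) (q : ℝ) :
    ∫⁻ v, ENNReal.ofReal (ellNorm p v ^ q) ∂diracProd x μ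
      = ∫⁻ u, ENNReal.ofReal ((ellNorm p x ^ p + |u| ^ p) ^ (q / p)) ∂μ := by
  simp only [ellNorm_rpow hp]
  rw [diracProd_eq_map, lintegral_map _ (measurable_snoc_const x)]
  · simp
  · have := measurable_init d
    unfold ellNorm
    fun_prop

theorem lintegral_rpow_lt_top_of_memP {p q : ℝ} (hp : 1 ≤ p) {μ : Measure ℝ}
    (h : MemP q p (onLine μ)) : ∫⁻ u, ENNReal.ofReal (|u| ^ q) ∂μ < ∞ := by
  have hp0 : p ≠ 0 := by linarith
  have := isProbabilityMeasure_of_memP_onLine h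
  have h2 := h.moment_lt_top
  rw [onLine_eq_diracProd 0, lintegral_ellNorm_diracProd _ _ hp] at h2
  simpa only [ellNorm_zero_dim hp, Real.zero_rpow hp0, zero_add, ← Real.rpow_mul (abs_nonneg _),
    mul_div_cancel₀ q hp0] using h2

/-- Doubling the larger of two summands bounds a power of a sum, for every exponent `r ≥ 0`. -/
theorem add_rpow_le_two_rpow_mul {a b r : ℝ} (ha : 0 ≤ a) (hb : 0 ≤ b) (hr : 0 ≤ r) :
    (a + b) ^ r ≤ 2 ^ r * (a ^ r + b ^ r) := by
  rw [mul_add, ← Real.mul_rpow zero_le_two ha, ← Real.mul_rpow zero_le_two hb]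
  rcases le_total a b with h | h
  · exact (Real.rpow_le_rpow (by positivity) (by linarith : a + b ≤ 2 * b) hr).trans
      (le_add_of_nonneg_left (by positivity))
  · exact (Real.rpow_le_rpow (by positivity) (by linarith : a + b ≤ 2 * a) hr).trans
      (le_add_of_nonneg_right (by positivity))

/-- A `q`-integrable function has finite `(A + |f| ^ p) ^ (q / p)`-cost under a finite measure. -/
theorem lintegral_cost_lt_top {α : Type*} [MeasurableSpace α] {ρ : Measure α} [IsFiniteMeasure ρ]
    {p q A : ℝ} (hp : 1 ≤ p) (hq : 1 ≤ q) (hA : 0 ≤ A) {f : α → ℝ}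
    (hf : ∫⁻ a, ENNReal.ofReal (|f a| ^ q) ∂ρ < ∞) :
    ∫⁻ a, ENNReal.ofReal ((A + |f a| ^ p) ^ (q / p)) ∂ρ < ∞ := by
  have hp0 : 0 < p := by linarith
  have hr : 0 ≤ q / p := by positivity
  have hle : ∀ a, ENNReal.ofReal ((A + |f a| ^ p) ^ (q / p)) ≤ ENNReal.ofReal (2 ^ (q / p))
      * (ENNReal.ofReal (A ^ (q / p)) + ENNReal.ofReal (|f a| ^ q)) := by
    intro a
    rw [← ENNReal.ofReal_add (by positivity) (by positivity),
      ← ENNReal.ofReal_mul (by positivity)]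
    refine ENNReal.ofReal_le_ofReal ((add_rpow_le_two_rpow_mul hA (by positivity) hr).trans_eq ?_)
    rw [← Real.rpow_mul (abs_nonneg _), mul_div_cancel₀ q hp0.ne']
  refine (lintegral_mono hle).trans_lt ?_
  rw [lintegral_const_mul' _ _ ENNReal.ofReal_ne_top, lintegral_add_left measurable_const,
    lintegral_const]
  exact ENNReal.mul_lt_top ENNReal.ofReal_lt_top (ENNReal.add_lt_top.2
    ⟨ENNReal.mul_lt_top ENNReal.ofReal_lt_top (measure_lt_top ρ _), hf⟩)

theorem memP_diracProd {d : ℕ} (x : Fin d → ℝ) {p q : ℝ} (hp : 1 ≤ p) (hq : 1 ≤ q)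
    {μ : Measure ℝ} (h : MemP q p (onLine μ)) : MemP q p (diracProd x μ) := by
  have := isProbabilityMeasure_of_memP_onLine h
  refine ⟨isProbabilityMeasure_diracProd x μ, ?_⟩
  rw [lintegral_ellNorm_diracProd x μ hp]
  exact lintegral_cost_lt_top hp hq (Real.rpow_nonneg (ellNorm_nonneg p _) _)
    (lintegral_rpow_lt_top_of_memP hp h)

theorem lintegral_quantileFn_rpow (q : ℝ) (μ : Measure ℝ) [IsProbabilityMeasure μ] :
    ∫⁻ t in Ioo 0 1, ENNReal.ofReal (|quantileFn μ t| ^ q) = ∫⁻ u, ENNReal.ofReal (|u| ^ q) ∂μ := by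
  conv_rhs => rw [← map_quantileFn μ]
  rw [lintegral_map' (by fun_prop) (aemeasurable_quantileFn μ)]

theorem lintegral_quantileFn_sub_lt_top {q : ℝ} (hq : 1 ≤ q) {μ ν : Measure ℝ}
    [IsProbabilityMeasure μ] [IsProbabilityMeasure ν]
    (hμ : ∫⁻ u, ENNReal.ofReal (|u| ^ q) ∂μ < ∞) (hν : ∫⁻ u, ENNReal.ofReal (|u| ^ q) ∂ν < ∞) :
    ∫⁻ t in Ioo 0 1, ENNReal.ofReal (|quantileFn μ t - quantileFn ν t| ^ q) < ∞ := by
  have hq0 : 0 ≤ q := by linarith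
  have hle : ∀ t, ENNReal.ofReal (|quantileFn μ t - quantileFn ν t| ^ q)
      ≤ ENNReal.ofReal (2 ^ q) * (ENNReal.ofReal (|quantileFn μ t| ^ q)
        + ENNReal.ofReal (|quantileFn ν t| ^ q)) := by
    intro t
    rw [← ENNReal.ofReal_add (by positivity) (by positivity),
      ← ENNReal.ofReal_mul (by positivity)]
    exact ENNReal.ofReal_le_ofReal ((Real.rpow_le_rpow (abs_nonneg _) (abs_sub _ _) hq0).trans
      (add_rpow_le_two_rpow_mul (abs_nonneg _) (abs_nonneg _) hq0))
  refine (lintegral_mono hle).trans_lt ?_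
  have hm := aemeasurable_quantileFn μ
  rw [lintegral_const_mul' _ _ ENNReal.ofReal_ne_top, lintegral_add_left' (by fun_prop),
    lintegral_quantileFn_rpow, lintegral_quantileFn_rpow]
  exact ENNReal.mul_lt_top ENNReal.ofReal_lt_top (ENNReal.add_lt_top.2 ⟨hμ, hν⟩)

theorem integrableOn_quantile_cost {p q A : ℝ} (hp : 1 ≤ p) (hq : 1 ≤ q) (hA : 0 ≤ A)
    {μ ν : Measure ℝ} (hμ : MemP q p (onLine μ)) (hν : MemP q p (onLine ν)) :
    IntegrableOn (fun t => (A + |quantileFn μ t - quantileFn ν t| ^ p) ^ (q / p)) (Ioo 0 1) := by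
  have := isProbabilityMeasure_of_memP_onLine hμ
  have := isProbabilityMeasure_of_memP_onLine hν
  have h1 := aemeasurable_quantileFn μ
  have h2 := aemeasurable_quantileFn ν
  have hm : AEMeasurable (fun t => (A + |quantileFn μ t - quantileFn ν t| ^ p) ^ (q / p))
      (volume.restrict (Ioo 0 1)) := by fun_prop
  refine ⟨hm.aestronglyMeasurable, ?_⟩
  rw [hasFiniteIntegral_iff_ofReal (ae_of_all _ fun t => by positivity)]
  exact lintegral_cost_lt_top hp hq hA (lintegral_quantileFn_sub_lt_top hq
    (lintegral_rpow_lt_top_of_memP hp hμ) (lintegral_rpow_lt_top_of_memP hp hν))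

theorem theorem1 {d : ℕ} (x y : Fin d → ℝ) :
    (∀ p q : ℝ, 1 ≤ p → 1 ≤ q → ∀ μ ν : Measure ℝ,
      MemP q p (onLine μ) → MemP q p (onLine ν) →
        MemP q p (diracProd x μ) ∧ MemP q p (diracProd y ν) ∧
        IntervalIntegrable
          (fun t : ℝ =>
            (ellNorm p (x - y) ^ p + |quantileFn μ t - quantileFn ν t| ^ p) ^ (q / p))
          volume 0 1 ∧
        wassersteinDist q p (diracProd x μ) (diracProd y ν) =
          ENNReal.ofReal
            ((∫ t in (0 : ℝ)..1,
              (ellNorm p (x - y) ^ p + |quantileFn μ t - quantileFn ν t| ^ p) ^ (q / p))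
                ^ (1 / q))) ∧
    (∀ μ ν : Measure ℝ, MemP 1 1 (onLine μ) → MemP 1 1 (onLine ν) →
        wassersteinDist 1 1 (diracProd x μ) (diracProd y ν) =
          ENNReal.ofReal (ellNorm 1 (x - y)) + wassersteinDist 1 1 (onLine μ) (onLine ν)) ∧
    (∀ μ ν : Measure ℝ, MemP 2 2 (onLine μ) → MemP 2 2 (onLine ν) →
        wassersteinDist 2 2 (diracProd x μ) (diracProd y ν) ^ 2 =
          ENNReal.ofReal (ellNorm 2 (x - y) ^ 2) +
            wassersteinDist 2 2 (onLine μ) (onLine ν) ^ 2) := by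
  refine ⟨fun p q hp hq μ ν hμ hν => ?_, fun μ ν hμ hν => ?_, fun μ ν hμ hν => ?_⟩
  · have := isProbabilityMeasure_of_memP_onLine hμ
    have := isProbabilityMeasure_of_memP_onLine hν
    have hA : 0 ≤ ellNorm p (x - y) ^ p := Real.rpow_nonneg (ellNorm_nonneg p _) _
    have hint := integrableOn_quantile_cost hp hq hA hμ hν
    have hnn : ∀ t, 0 ≤ (ellNorm p (x - y) ^ p + |quantileFn μ t - quantileFn ν t| ^ p) ^ (q / p) :=
      fun t => by positivity
    refine ⟨memP_diracProd x hp hq hμ, memP_diracProd y hp hq hν,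
      (intervalIntegrable_iff_integrableOn_Ioo_of_le zero_le_one).2 hint, ?_⟩
    rw [wassersteinDist, transportCost_diracProd x y hp hq,
      ← ofReal_integral_eq_lintegral_ofReal hint (ae_of_all _ hnn),
      ENNReal.ofReal_rpow_of_nonneg (integral_nonneg hnn) (by positivity),
      intervalIntegral.integral_of_le zero_le_one, integral_Ioc_eq_integral_Ioo]
  · have := isProbabilityMeasure_of_memP_onLine hμ
    have := isProbabilityMeasure_of_memP_onLine hν
    have hA := ellNorm_nonneg 1 (x - y)
    simp only [wassersteinDist, transportCost_diracProd x y le_rfl le_rfl,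
      transportCost_onLine le_rfl le_rfl, div_one, Real.rpow_one, ENNReal.rpow_one,
      ENNReal.ofReal_add hA (abs_nonneg _)]
    rw [lintegral_add_left measurable_const]
    simp
  · have := isProbabilityMeasure_of_memP_onLine hμ
    have := isProbabilityMeasure_of_memP_onLine hν
    have hsqrt : ∀ a : ℝ≥0∞, (a ^ (1 / 2 : ℝ)) ^ 2 = a := fun a => by
      rw [← ENNReal.rpow_natCast, ← ENNReal.rpow_mul]
      norm_num
    simp only [wassersteinDist, hsqrt, transportCost_diracProd x y one_le_two one_le_two,
      transportCost_onLine one_le_two one_le_two, div_self (two_ne_zero' ℝ), Real.rpow_one,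
      Real.rpow_two, ENNReal.ofReal_add (sq_nonneg _) (sq_nonneg _)]
    rw [lintegral_add_left measurable_const]
    simp
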